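/- \textbf{Setting.} Let $L,R,\rho_f,\rho_s,h_s,\beta>0$, let $\Omega_f=(0,L)\times(0,R)$ and $\Sigma=(0,L)\times\{R\}$ (identified with $(0,L)$, unit normal $\boldsymbol n=(0,1)$), and let $0<\alpha\le 1$, $\Delta t>0$. The LC-DN-$\alpha$ scheme for the benchmark problem (linear inviscid incompressible fluid coupled with an independent-rings membrane, no forcing) computes, from three initial time levels, $\boldsymbol u^{n+1},p^{n+1}$ on $\Omega_f$ and $\eta^{n+1},w^{n+1}$ on $\Sigma$ for $n\ge 2$ by \[ \rho_f\frac{\boldsymbol u^{n+1}}{\Delta t}+\nabla p^{n+1}=\rho_f\frac{\boldsymbol u^{n}}{\Delta t}+(1-\alpha)\Big(\rho_f\frac{\boldsymbol u^{n}-\boldsymbol u^{n-1}}{\Delta t}+\nabla p^{n}\Big),\qquad \nabla\cdot\boldsymbol u^{n+1}=(1-\alpha)\nabla\cdot\boldsymbol u^{n}\quad\text{in }\Omega_f, \] \[ \boldsymbol u^{n+1}\cdot\boldsymbol n=(1-\alpha)\boldsymbol u^{n}\cdot\boldsymbol n+\alpha w^n\quad\text{on }\Sigma, \] \[ \rho_sh_s\frac{\eta^{n+1}}{\Delta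 t^2}+\beta\eta^{n+1}-p^{n+1}=\rho_sh_s\frac{2\eta^n-\eta^{n-1}}{\Delta t^2}+(1-\alpha)\Big(\rho_sh_s\frac{\eta^n-2\eta^{n-1}+\eta^{n-2}}{\Delta t^2}+\beta\eta^n-p^n\Big),\qquad w^{n+1}=\frac{\eta^{n+1}-\eta^n}{\Delta t}\quad\text{on }\Sigma, \] together with, at all time levels $n$, $p^n=0$ on the inlet $x=0$ and the outlet $x=L$, and $\boldsymbol u^n\cdot\boldsymbol n=0$ on the symmetry axis $y=0$. Solutions are classical: for every $n$, $\boldsymbol u^n,p^n$ are continuous on $\overline{\Omega_f}$ and differentiable in $\Omega_f$, and $\eta^n$ is continuous on $[0,L]$. For $i\ge1$ let $\mu_i=\dfrac{L}{i\pi\tanh(i\pi R/L)}$ be the eigenvalues of the added-mass operator, $z_i(x)=\sqrt{2/L}\,\sin(i\pi x/L)$ its eigenfunctions, \[ \overline\alpha_i=\frac{2\,\frac{\rho_sh_s}{\rho_f\mu_i}}{\frac{\rho_sh_s}{\rho_f\mu_i}+1}, \] and let $\chi_i$ be the modal characteristic polynomial \[ \chi_i(y)=\Big[\tfrac{\rho_sh_s}{\Delta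 t^2}+\beta\Big]y^3+\Big[\alpha\tfrac{\rho_f\mu_i}{\Delta t^2}-\beta(1-\alpha)-3\tfrac{\rho_sh_s}{\Delta t^2}+\alpha\tfrac{\rho_sh_s}{\Delta t^2}\Big]y^2+\Big[3\tfrac{\rho_sh_s}{\Delta t^2}-2\alpha\tfrac{\rho_f\mu_i}{\Delta t^2}-2\alpha\tfrac{\rho_sh_s}{\Delta t^2}\Big]y+\Big[-(1-\alpha)\tfrac{\rho_sh_s}{\Delta t^2}+\alpha\tfrac{\rho_f\mu_i}{\Delta t^2}\Big]. \] \textbf{Proposition.} Let $0<\alpha\le1$. (1) (Modes.) Let $i\ge1$ with $\frac{\rho_sh_s}{\rho_f\mu_i}<1$. Then $\overline\alpha_i<1$. If moreover $\alpha<\overline\alpha_i$, then for every $\Delta t>0$ all complex roots of $\chi_i$ have modulus less than $1$, and every solution of the scheme satisfies $\int_0^L\eta^n z_i\,dx\to0$ as $n\to\infty$. (2) (Scheme.) If $\alpha<\overline\alpha_i$ for every $i\ge1$ with $\frac{\rho_sh_s}{\rho_f\mu_i}<1$, then the scheme is unconditionally absolutely stable: for every $\Delta t>0$ and every solution of the scheme,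 $\eta^n$, $w^n$, $p^n|_\Sigma$ and $(\boldsymbol u^n\cdot\boldsymbol n)|_\Sigma$ all tend to $0$ in $L^2(\Sigma)$ as $n\to\infty$. -/

import Mathlib

open Filter Topology MeasureTheory Set

noncomputable section

namespace FSI

/-- Data of the benchmark problem: length `L` and height `R` of the rectangular fluid domain,
fluid density `ρf`, structure density `ρs`, structure thickness `hs` and elastic coefficient `β`. -/
structure Benchmark where
  L : ℝ
  R : ℝ
  ρf : ℝ
  ρs : ℝ
  hs : ℝ
  β : ℝ
  L_pos : 0 < L
  R_pos : 0 < R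
  ρf_pos : 0 < ρf
  ρs_pos : 0 < ρs
  hs_pos : 0 < hs
  β_pos : 0 < β

/-- Gradient of a scalar field on the plane. -/
def grad (f : ℝ × ℝ → ℝ) (z : ℝ × ℝ) : ℝ × ℝ :=
  (fderiv ℝ f z (1, 0), fderiv ℝ f z (0, 1))

/-- Divergence of a vector field on the plane. -/
def divergence (v : ℝ × ℝ → ℝ × ℝ) (z : ℝ × ℝ) : ℝ :=
  (fderiv ℝ v z (1, 0)).1 + (fderiv ℝ v z (0, 1)).2

namespace Benchmark

variable (B : Benchmark)

/-- The open fluid domain `Ω_f = (0, L) × (0, R)`. Its boundary consists of the inlet `x = 0`,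
the outlet `x = L`, the symmetry axis `y = 0`, and the interface `Σ` at `y = R`, which is also
the domain of the structure and is parametrized by `x ∈ (0, L)`. -/
def fluidDomain : Set (ℝ × ℝ) := Ioo 0 B.L ×ˢ Ioo 0 B.R

/-- The closed fluid domain. -/
def closedFluidDomain : Set (ℝ × ℝ) := Icc 0 B.L ×ˢ Icc 0 B.R

/-- The sequences `u` (fluid velocity), `p` (fluid pressure), `η` (normal displacement of the
structure) and `w` (structure velocity) are a classical solution of the LC-DN-`α` scheme with time
step `dt` for the benchmark problem, with no forcing. Time levels `0, 1, 2` are initial data; each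
later level `n + 3` is computed from the previous ones. The unit normal on `Σ` is `(0, 1)`, so that
`u · n` on `Σ` is the second component of `u`. -/
structure IsLCDNSolution (α dt : ℝ) (u : ℕ → ℝ × ℝ → ℝ × ℝ) (p : ℕ → ℝ × ℝ → ℝ)
    (η w : ℕ → ℝ → ℝ) : Prop where
  u_cont : ∀ n, ContinuousOn (u n) B.closedFluidDomain
  u_diff : ∀ n, ∀ z ∈ B.fluidDomain, DifferentiableAt ℝ (u n) z
  p_cont : ∀ n, ContinuousOn (p n) B.closedFluidDomain
  p_diff : ∀ n, ∀ z ∈ B.fluidDomain, DifferentiableAt ℝ (p n) z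
  η_cont : ∀ n, ContinuousOn (η n) (Icc 0 B.L)
  /-- zero pressure at the inlet -/
  p_inlet : ∀ n, ∀ y ∈ Ioo 0 B.R, p n (0, y) = 0
  /-- zero pressure at the outlet -/
  p_outlet : ∀ n, ∀ y ∈ Ioo 0 B.R, p n (B.L, y) = 0
  /-- zero normal velocity on the symmetry axis -/
  u_symm : ∀ n, ∀ x ∈ Ioo 0 B.L, (u n (x, 0)).2 = 0
  /-- fluid momentum equation -/
  momentum : ∀ n, ∀ z ∈ B.fluidDomain,
    (B.ρf / dt) • u (n + 3) z + grad (p (n + 3)) z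
      = (B.ρf / dt) • u (n + 2) z
        + (1 - α) • ((B.ρf / dt) • (u (n + 2) z - u (n + 1) z) + grad (p (n + 2)) z)
  /-- continuity equation -/
  continuity : ∀ n, ∀ z ∈ B.fluidDomain,
    divergence (u (n + 3)) z = (1 - α) * divergence (u (n + 2)) z
  /-- Dirichlet condition for the fluid at the interface -/
  interface : ∀ n, ∀ x ∈ Ioo 0 B.L,
    (u (n + 3) (x, B.R)).2 = (1 - α) * (u (n + 2) (x, B.R)).2 + α * w (n + 2) x
  /-- structure equation -/
  membrane : ∀ n, ∀ x ∈ Ioo 0 B.L,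
    B.ρs * B.hs * (η (n + 3) x / dt ^ 2) + B.β * η (n + 3) x - p (n + 3) (x, B.R)
      = B.ρs * B.hs * ((2 * η (n + 2) x - η (n + 1) x) / dt ^ 2)
        + (1 - α) * (B.ρs * B.hs * ((η (n + 2) x - 2 * η (n + 1) x + η n x) / dt ^ 2)
            + B.β * η (n + 2) x - p (n + 2) (x, B.R))
  /-- update of the structure velocity -/
  velocity : ∀ n, ∀ x ∈ Ioo 0 B.L, w (n + 3) x = (η (n + 3) x - η (n + 2) x) / dt

/-- Convergence to zero in `L²(Σ)` of a sequence of functions on the interface. -/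
def TendstoZeroL2 (f : ℕ → ℝ → ℝ) : Prop :=
  Tendsto (fun n => eLpNorm (f n) 2 (volume.restrict (Ioo 0 B.L))) atTop (𝓝 0)

/-- Absolute stability of the LC-DN-`α` scheme with time step `dt`: for arbitrary initial data the
displacement, the structure velocity, the interface pressure and the normal fluid velocity at the
interface are all damped out in `L²(Σ)`. -/
def AbsolutelyStable (α dt : ℝ) : Prop :=
  ∀ (u : ℕ → ℝ × ℝ → ℝ × ℝ) (p : ℕ → ℝ × ℝ → ℝ) (η w : ℕ → ℝ → ℝ),
    B.IsLCDNSolution α dt u p η w →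
      B.TendstoZeroL2 η ∧ B.TendstoZeroL2 w ∧
      B.TendstoZeroL2 (fun n x => p n (x, B.R)) ∧
      B.TendstoZeroL2 (fun n x => (u n (x, B.R)).2)

/-- Absolute stability for every time step. -/
def UnconditionallyAbsolutelyStable (α : ℝ) : Prop :=
  ∀ dt : ℝ, 0 < dt → B.AbsolutelyStable α dt

/-- The eigenvalue `μ i` of the added-mass operator (`i ≥ 1`). -/
def μ (i : ℕ) : ℝ :=
  B.L / (i * Real.pi * Real.tanh (i * Real.pi * B.R / B.L))

/-- The `L²(Σ)`-normalized eigenfunction `z i` of the added-mass operator for `μ i` (`i ≥ 1`). -/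
def z (i : ℕ) (x : ℝ) : ℝ :=
  Real.sqrt (2 / B.L) * Real.sin (i * Real.pi * x / B.L)

/-- The ratio `ρ_s h_s / (ρ_f μ_i)`. -/
def massRatio (i : ℕ) : ℝ := B.ρs * B.hs / (B.ρf * B.μ i)

/-- The threshold for `α` associated with the mode `i`. -/
def αbar (i : ℕ) : ℝ := 2 * B.massRatio i / (B.massRatio i + 1)

open Polynomial in
/-- The characteristic polynomial of the finite difference equation satisfied by the `i`-th
Fourier coefficient of the displacement. -/
def χ (α dt : ℝ) (i : ℕ) : ℝ[X] :=
  C (B.ρs * B.hs / dt ^ 2 + B.β) * X ^ 3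
    + C (α * (B.ρf * B.μ i / dt ^ 2) - B.β * (1 - α) - 3 * (B.ρs * B.hs / dt ^ 2)
        + α * (B.ρs * B.hs / dt ^ 2)) * X ^ 2
    + C (3 * (B.ρs * B.hs / dt ^ 2) - 2 * α * (B.ρf * B.μ i / dt ^ 2)
        - 2 * α * (B.ρs * B.hs / dt ^ 2)) * X
    + C (-(1 - α) * (B.ρs * B.hs / dt ^ 2) + α * (B.ρf * B.μ i / dt ^ 2))

/-- Absolute stability of the mode `i` for the time step `dt`: all complex roots of the
characteristic polynomial lie in the open unit disc, and the `i`-th Fourier coefficient of the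
displacement is damped out for arbitrary initial data. -/
def ModeAbsolutelyStable (α dt : ℝ) (i : ℕ) : Prop :=
  (∀ y : ℂ, Polynomial.aeval y (B.χ α dt i) = 0 → ‖y‖ < 1) ∧
  ∀ (u : ℕ → ℝ × ℝ → ℝ × ℝ) (p : ℕ → ℝ × ℝ → ℝ) (η w : ℕ → ℝ → ℝ),
    B.IsLCDNSolution α dt u p η w →
      Tendsto (fun n => ∫ x in (0 : ℝ)..B.L, η n x * B.z i x) atTop (𝓝 0)

end Benchmark

end FSI

end

/-!
The scheme propagates residuals geometrically: the residuals of the fluid and of the structure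
equations and the divergence of the velocity are multiplied by `1 - α` at each step. Hence, from
some level on, `p (n + 1) - (1 - α) p n` is harmonic, vanishes at inlet and outlet, and its normal
derivative on the interface is a multiple of the second difference of the displacement. Green's
identity against `sin (k x) * cosh (k y)` (`integral_normal_deriv_mul_sin`) turns this into the
added-mass relation between the sine coefficients, so each sine coefficient of `η` satisfies a
third-order recurrence with characteristic polynomial `χ`
(`IsLCDNSolution.sineCoeff_recurrence`). The fields are only pointwise differentiable; this suffices
for the divergence theorem because the divergence in Green's identity vanishes identically.

With `M = ρs hs / dt²` and `A = ρf μ / dt²` the characteristic polynomial is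
`(y - 1 + α) (M (y - 1)² + β y²) + α A (y - 1)²`. A Möbius map and the Routh–Hurwitz criterion show
that its roots lie in the open unit disc as soon as `α (M + A) ≤ 2 M`
(`norm_lt_one_of_modalPoly_eq_zero`); this condition reads `α ≤ αbar`, and it holds by itself when
the mass ratio is at least one. This gives the statement on single modes.

For convergence in `L²` the decay must be uniform in the mode. As `i → ∞` the added mass tends to
`0`, and `A = 0` is still a stable value, so all modes are covered by the compact interval of
admissible `A`, on which the moduli of the roots are bounded by some `ρ < 1`
(`exists_uniform_decay`). Parseval's identity for sine series then gives `η → 0` in `L²`, and the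
remaining unknowns follow from `η` through linear relations and contractions with factor `1 - α`.
-/

noncomputable section

namespace FSI

/-! ### Stability of the characteristic polynomials -/

/-- The Routh–Hurwitz criterion for cubics. -/
theorem hurwitz_cubic {a b c d : ℝ} (ha : 0 < a) (hb : 0 < b) (hc : 0 < c) (hd : 0 < d)
    (h : a * d < b * c) {t : ℂ} (ht : a * t ^ 3 + b * t ^ 2 + c * t + d = 0) : t.re < 0 := by
  obtain ⟨x, ω⟩ := t
  have hre := congrArg Complex.re ht
  have him := congrArg Complex.im ht
  simp only [pow_succ, pow_zero, one_mul, Complex.add_re, Complex.mul_re, Complex.add_im,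
    Complex.mul_im, Complex.ofReal_re, Complex.ofReal_im, Complex.zero_re, Complex.zero_im]
    at hre him
  by_contra! hx
  simp only at hx
  by_cases hω : ω = 0
  · subst hω
    have : 0 ≤ a * x ^ 3 + b * x ^ 2 + c * x := by positivity
    nlinarith
  -- the imaginary part determines `ω²`, and then the real part is negative
  have h1 : a * ω ^ 2 = 3 * a * x ^ 2 + 2 * b * x + c := by
    apply mul_left_cancel₀ hω
    linear_combination -him
  have h2 : a * (-8 * a * x ^ 3 - 8 * b * x ^ 2 - 2 * c * x + d) - 2 * b ^ 2 * x - b * c = 0 := by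
    linear_combination a * hre + (3 * x * a + b) * h1
  have : 0 ≤ a * (8 * a * x ^ 3 + 8 * b * x ^ 2 + 2 * c * x) + 2 * b ^ 2 * x := by positivity
  nlinarith

/-- The characteristic polynomial of one mode, with `M = ρs hs / dt²` and `A = ρf μ / dt²`. -/
def modalPoly (M β α A : ℝ) (y : ℂ) : ℂ :=
  (M + β) * y ^ 3 + (α * A - β * (1 - α) - 3 * M + α * M) * y ^ 2
    + (3 * M - 2 * α * A - 2 * α * M) * y + (-(1 - α) * M + α * A)

/-- The Möbius map `y ↦ (y + 1) / (2 (y - 1))` sends the outside of the unit disc to the right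
half plane, where `hurwitz_cubic` excludes roots. -/
theorem norm_lt_one_of_modalPoly_eq_zero {M β α A : ℝ} (hM : 0 < M) (hβ : 0 < β) (hα : 0 < α)
    (hα1 : α ≤ 1) (hA : 0 ≤ A) (hAM : α * (M + A) ≤ 2 * M) {y : ℂ}
    (hy : modalPoly M β α A y = 0) : ‖y‖ < 1 := by
  have hy1 : y ≠ 1 := by
    rintro rfl
    have : ((α * β : ℝ) : ℂ) = 0 := by
      rw [← hy, modalPoly]; push_cast; ring
    have h2 : 0 < α * β := by positivity
    exact h2.ne' (by exact_mod_cast this)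
  have hy1' : y - 1 ≠ 0 := sub_ne_zero.2 hy1
  set t : ℂ := (y + 1) / (2 * (y - 1)) with ht
  have key := hurwitz_cubic (a := α * β) (b := β * (1 + α / 2))
    (c := β * (1 - α / 4) + α * (M + A)) (d := β * (2 - α) / 8 + M - α * (M + A) / 2) (t := t)
    (by positivity) (by positivity) (by nlinarith [mul_pos hα hM, mul_nonneg hα.le hA])
    (by nlinarith) ?_ ?_
  · rw [ht, Complex.div_re, ← add_div] at key
    have hn : 0 < Complex.normSq (2 * (y - 1)) := Complex.normSq_pos.2 (by simpa using hy1')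
    have h3 := (div_lt_iff₀ hn).1 key
    simp at h3
    have h4 : ‖y‖ ^ 2 < 1 := by
      rw [← Complex.normSq_eq_norm_sq, Complex.normSq_apply]
      nlinarith
    nlinarith [norm_nonneg y]
  · have e : β * (1 + α / 2) * (β * (1 - α / 4) + α * (M + A))
        - α * β * (β * (2 - α) / 8 + M - α * (M + A) / 2)
        = β * (β + α * A + α * (α * (M + A))) := by ring
    have : 0 < β * (β + α * A + α * (α * (M + A))) := by positivity
    linarith
  · have : (((α * β : ℝ) : ℂ) * t ^ 3 + ((β * (1 + α / 2) : ℝ) : ℂ) * t ^ 2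
      + ((β * (1 - α / 4) + α * (M + A) : ℝ) : ℂ) * t
      + ((β * (2 - α) / 8 + M - α * (M + A) / 2 : ℝ) : ℂ)) = modalPoly M β α A y / (y - 1) ^ 3 := by
      rw [ht, modalPoly]
      push_cast
      field_simp
      ring
    rw [this, hy, zero_div]

/-- The roots stay away from the unit circle uniformly in the added-mass parameter `A`, because the
admissible values of `A`, with the limit `0` included, form a compact interval. -/
theorem exists_uniform_root_bound {M β α : ℝ} (hM : 0 < M) (hβ : 0 < β) (hα : 0 < α)
    (hα1 : α ≤ 1) : ∃ ρ : ℝ, 0 < ρ ∧ ρ < 1 ∧ ∀ A : ℝ, 0 ≤ A → α * (M + A) ≤ 2 * M →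
      ∀ y : ℂ, modalPoly M β α A y = 0 → ‖y‖ ≤ ρ := by
  set Amax := 2 * M / α - M with hAm
  have hadm : ∀ A, α * (M + A) ≤ 2 * M ↔ A ≤ Amax := fun A => by
    rw [hAm, le_sub_iff_add_le, le_div_iff₀ hα, mul_comm, add_comm M]
  set S : Set (ℝ × ℂ) := (Icc 0 Amax ×ˢ Metric.closedBall (0 : ℂ) 1) ∩
    {q | modalPoly M β α q.1 q.2 = 0} with hS
  have hcl : IsClosed {q : ℝ × ℂ | modalPoly M β α q.1 q.2 = 0} := by
    refine isClosed_eq ?_ continuous_const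
    unfold modalPoly
    fun_prop
  have hSc : IsCompact S := (isCompact_Icc.prod (isCompact_closedBall _ _)).inter_right hcl
  have hmem : ∀ A : ℝ, 0 ≤ A → α * (M + A) ≤ 2 * M → ∀ y : ℂ, modalPoly M β α A y = 0 →
      (A, y) ∈ S := fun A h0 h1 y hy =>
    ⟨⟨⟨h0, (hadm A).1 h1⟩, by
      simpa using (norm_lt_one_of_modalPoly_eq_zero hM hβ hα hα1 h0 h1 hy).le⟩, hy⟩
  rcases S.eq_empty_or_nonempty with he | hne
  · refine ⟨1 / 2, by norm_num, by norm_num, fun A h0 h1 y hy => ?_⟩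
    exact absurd (hmem A h0 h1 y hy) (by simp [he])
  · obtain ⟨q, hq, hmax⟩ := hSc.exists_isMaxOn hne (f := fun q : ℝ × ℂ => ‖q.2‖)
      (by fun_prop)
    have hq1 : ‖q.2‖ < 1 :=
      norm_lt_one_of_modalPoly_eq_zero hM hβ hα hα1 hq.1.1.1 ((hadm _).2 hq.1.1.2) hq.2
    refine ⟨(‖q.2‖ + 1) / 2, by positivity, by linarith, fun A h0 h1 y hy => ?_⟩
    have : ‖y‖ ≤ ‖q.2‖ := hmax (hmem A h0 h1 y hy)
    linarith

/-! ### Decay of the solutions of third-order recurrences -/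

theorem exists_roots_of_cubic {a : ℂ} (b c d : ℂ) (ha : a ≠ 0) :
    ∃ r s t : ℂ, b = a * -(r + s + t) ∧ c = a * (r * s + r * t + s * t) ∧
      d = a * -(r * s * t) := by
  set P : Cubic ℂ := ⟨a, b, c, d⟩
  obtain ⟨r, s, t, h⟩ := (Cubic.splits_iff_roots_eq_three (P := P) (φ := RingHom.id ℂ) ha).1
    (IsAlgClosed.splits _)
  have := Cubic.eq_sum_three_roots (P := P) (φ := RingHom.id ℂ) ha h
  simp only [Cubic.map, RingHom.id_apply, Cubic.mk.injEq, P] at this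
  exact ⟨r, s, t, this.2.1, this.2.2.1, this.2.2.2⟩

/-- A first-order recurrence with a forcing term that decays like `(n + 1)ᵏ ρⁿ`. -/
theorem norm_le_of_first_order {ρ D E : ℝ} (hρ : 0 < ρ) {r : ℂ} (hr : ‖r‖ ≤ ρ) {k : ℕ} {e : ℕ → ℂ}
    (he : ∀ n, ‖e (n + 1) - r * e n‖ ≤ D * (n + 1) ^ k * ρ ^ n) (h0 : ‖e 0‖ ≤ E)
    (hD : D ≤ E * ρ) (n : ℕ) : ‖e n‖ ≤ E * (n + 1) ^ (k + 1) * ρ ^ n := by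
  have hE : 0 ≤ E := (norm_nonneg _).trans h0
  induction n with
  | zero => simpa using h0
  | succ n ih =>
    have hstep : ‖e (n + 1)‖ ≤ ‖e (n + 1) - r * e n‖ + ‖r‖ * ‖e n‖ := by
      rw [← norm_mul]
      simpa using norm_add_le (e (n + 1) - r * e n) (r * e n)
    have hmul : ‖r‖ * ‖e n‖ ≤ ρ * (E * (n + 1) ^ (k + 1) * ρ ^ n) := by gcongr
    have hforce : D * (n + 1) ^ k * ρ ^ n ≤ E * ρ * (n + 1) ^ k * ρ ^ n := by gcongr
    calc ‖e (n + 1)‖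
        ≤ E * ρ * (n + 1) ^ k * ρ ^ n + ρ * (E * (n + 1) ^ (k + 1) * ρ ^ n) := by
          linarith [he n]
      _ = E * (((n : ℝ) + 1) ^ k * (n + 2)) * ρ ^ (n + 1) := by ring
      _ ≤ E * (((n : ℝ) + 2) ^ k * (n + 2)) * ρ ^ (n + 1) := by gcongr; norm_num
      _ = E * (((n + 1 : ℕ) : ℝ) + 1) ^ (k + 1) * ρ ^ (n + 1) := by push_cast; ring

/-- The bound depends on the recurrence only through a bound `ρ` on its characteristic roots. -/
theorem norm_le_of_third_order {ρ : ℝ} (hρ : 0 < ρ) (hρ1 : ρ < 1) {a₃ a₂ a₁ a₀ : ℂ} (ha : a₃ ≠ 0)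
    (hroot : ∀ y : ℂ, a₃ * y ^ 3 + a₂ * y ^ 2 + a₁ * y + a₀ = 0 → ‖y‖ ≤ ρ) {c : ℕ → ℂ}
    (hc : ∀ n, a₃ * c (n + 3) + a₂ * c (n + 2) + a₁ * c (n + 1) + a₀ * c n = 0) (n : ℕ) :
    ‖c n‖ ≤ 4 / ρ ^ 2 * (‖c 0‖ + ‖c 1‖ + ‖c 2‖) * (n + 1) ^ 2 * ρ ^ n := by
  obtain ⟨r, s, t, rfl, rfl, rfl⟩ := exists_roots_of_cubic a₂ a₁ a₀ ha
  have hr : ‖r‖ ≤ ρ := hroot r (by ring)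
  have hs : ‖s‖ ≤ ρ := hroot s (by ring)
  have ht : ‖t‖ ≤ ρ := hroot t (by ring)
  set S := ‖c 0‖ + ‖c 1‖ + ‖c 2‖ with hS
  have p0 := norm_nonneg (c 0)
  have p1 := norm_nonneg (c 1)
  have p2 := norm_nonneg (c 2)
  have hS0 : 0 ≤ S := by positivity
  have hρinv : 1 ≤ 1 / ρ := by rw [le_div_iff₀ hρ]; linarith
  -- with `T` the shift, bound `(T - s)(T - t) c`, then `(T - t) c`, then `c`
  have hd : ∀ n, ‖c (n + 2) - (s + t) * c (n + 1) + s * t * c n‖ ≤ 4 * S * ρ ^ n := by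
    intro n
    induction n with
    | zero =>
      have b1 : ‖(s + t) * c 1‖ ≤ 2 * ‖c 1‖ := by
        rw [norm_mul]; gcongr; linarith [norm_add_le s t]
      have b2 : ‖s * t * c 0‖ ≤ 1 * ‖c 0‖ := by
        rw [norm_mul, norm_mul]; gcongr
        nlinarith [norm_nonneg s, norm_nonneg t]
      have b3 := norm_add_le (c 2 - (s + t) * c 1) (s * t * c 0)
      have b4 := norm_sub_le (c 2) ((s + t) * c 1)
      simp only [zero_add, pow_zero, mul_one]
      linarith
    | succ n ih =>
      have e : c (n + 3) - (s + t) * c (n + 2) + s * t * c (n + 1)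
          = r * (c (n + 2) - (s + t) * c (n + 1) + s * t * c n) := by
        apply mul_left_cancel₀ ha
        linear_combination hc n
      change ‖c (n + 3) - (s + t) * c (n + 2) + s * t * c (n + 1)‖ ≤ _
      rw [e, norm_mul]
      calc _ ≤ ρ * (4 * S * ρ ^ n) := by gcongr
        _ = _ := by ring
  have he : ∀ n, ‖c (n + 1) - t * c n‖ ≤ 4 * S / ρ * (n + 1) ^ (0 + 1) * ρ ^ n := by
    refine norm_le_of_first_order (D := 4 * S) hρ hs (e := fun n => c (n + 1) - t * c n)
      (fun n => ?_) ?_ (by field_simp; rfl)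
    · have := hd n
      convert this using 2 <;> ring
    · have b1 : ‖t * c 0‖ ≤ 1 * ‖c 0‖ := by rw [norm_mul]; gcongr; linarith
      have b2 := norm_sub_le (c 1) (t * c 0)
      have : 4 * S ≤ 4 * S / ρ := by rw [le_div_iff₀ hρ]; nlinarith
      simp only [zero_add]
      linarith
  have := norm_le_of_first_order (E := 4 * S / ρ ^ 2) hρ ht he ?_ (le_of_eq (by field_simp)) n
  · convert this using 1; ring
  · have : 4 * S ≤ 4 * S / ρ ^ 2 := by
      rw [le_div_iff₀ (by positivity)]
      nlinarith [pow_le_one₀ hρ.le hρ1.le (n := 2)]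
    linarith

/-- All modes decay at one common rate. -/
theorem exists_uniform_decay {M β α : ℝ} (hM : 0 < M) (hβ : 0 < β) (hα : 0 < α) (hα1 : α ≤ 1) :
    ∃ κ : ℕ → ℝ, Tendsto κ atTop (𝓝 0) ∧ ∀ A : ℝ, 0 ≤ A → α * (M + A) ≤ 2 * M →
      ∀ c : ℕ → ℝ, (∀ n, (M + β) * c (n + 3) + (α * A - β * (1 - α) - 3 * M + α * M) * c (n + 2)
        + (3 * M - 2 * α * A - 2 * α * M) * c (n + 1) + (-(1 - α) * M + α * A) * c n = 0) →
      ∀ n, |c n| ≤ κ n * (|c 0| + |c 1| + |c 2|) := by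
  obtain ⟨ρ, hρ, hρ1, hroot⟩ := exists_uniform_root_bound hM hβ hα hα1
  refine ⟨fun n => 4 / ρ ^ 2 * ((n + 1) ^ 2 * ρ ^ n), ?_, ?_⟩
  · have h := (tendsto_pow_const_mul_const_pow_of_abs_lt_one 2
      (r := ρ) (by rwa [abs_of_pos hρ])).comp (tendsto_add_atTop_nat 1)
    have h2 := h.const_mul (4 / ρ ^ 2 * ρ⁻¹)
    rw [mul_zero] at h2
    refine h2.congr fun n => ?_
    simp only [Function.comp]
    push_cast
    field_simp
    ring
  · intro A hA hAM c hc n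
    have := norm_le_of_third_order hρ hρ1 (c := fun n => (c n : ℂ)) (a₃ := M + β)
      (a₂ := α * A - β * (1 - α) - 3 * M + α * M) (a₁ := 3 * M - 2 * α * A - 2 * α * M)
      (a₀ := -(1 - α) * M + α * A) (by exact_mod_cast (add_pos hM hβ).ne') (hroot A hA hAM)
      (fun n => by exact_mod_cast hc n) n
    simp only [Complex.norm_real, Real.norm_eq_abs] at this
    linarith

/-! ### The added-mass operator on one mode -/

/-- A harmonic function `q` on a rectangle that vanishes on the vertical sides, with normal
derivative zero on the bottom: the sine coefficients of its trace and of its normal derivative on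
the top side are proportional. Here `g` is the continuous extension of `∇q` to the closed rectangle;
only its pointwise divergence is assumed to vanish. The proof is Green's second identity with the
harmonic function `sin (k x) * cosh (k y)`. -/
theorem integral_normal_deriv_mul_sin {L R k : ℝ} (hL : 0 < L) (hR : 0 < R)
    (hk : Real.sin (k * L) = 0) {q : ℝ × ℝ → ℝ} {g : ℝ × ℝ → ℝ × ℝ}
    (hqc : ContinuousOn q (Icc 0 L ×ˢ Icc 0 R)) (hgc : ContinuousOn g (Icc 0 L ×ˢ Icc 0 R))
    (hqd : ∀ z ∈ Ioo 0 L ×ˢ Ioo 0 R, DifferentiableAt ℝ q z)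
    (hgd : ∀ z ∈ Ioo 0 L ×ˢ Ioo 0 R, DifferentiableAt ℝ g z)
    (hgrad : ∀ z ∈ Ioo 0 L ×ˢ Ioo 0 R, grad q z = g z)
    (hdiv : ∀ z ∈ Ioo 0 L ×ˢ Ioo 0 R, divergence g z = 0)
    (hq0 : ∀ y ∈ Ioo 0 R, q (0, y) = 0) (hqL : ∀ y ∈ Ioo 0 R, q (L, y) = 0)
    (hg0 : ∀ x ∈ Ioo 0 L, (g (x, 0)).2 = 0) :
    Real.cosh (k * R) * ∫ x in (0 : ℝ)..L, (g (x, R)).2 * Real.sin (k * x)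
      = k * Real.sinh (k * R) * ∫ x in (0 : ℝ)..L, q (x, R) * Real.sin (k * x) := by
  set F₁ : ℝ × ℝ → ℝ := fun z => (g z).1 * (Real.sin (k * z.1) * Real.cosh (k * z.2))
    - q z * (k * Real.cos (k * z.1) * Real.cosh (k * z.2)) with hF₁
  set F₂ : ℝ × ℝ → ℝ := fun z => (g z).2 * (Real.sin (k * z.1) * Real.cosh (k * z.2))
    - q z * (k * Real.sin (k * z.1) * Real.sinh (k * z.2)) with hF₂
  have hIcc : Icc ((0 : ℝ), (0 : ℝ)) (L, R) = Icc 0 L ×ˢ Icc 0 R := (Icc_prod_Icc _ _ _ _).symm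
  have hd₁ : ∀ z ∈ Ioo 0 L ×ˢ Ioo 0 R, DifferentiableAt ℝ F₁ z := fun z hz => by
    have h1 := hqd z hz
    have h2 := hgd z hz
    have : DifferentiableAt ℝ (fun z => (g z).1) z := h2.fst
    fun_prop
  have hd₂ : ∀ z ∈ Ioo 0 L ×ˢ Ioo 0 R, DifferentiableAt ℝ F₂ z := fun z hz => by
    have h1 := hqd z hz
    have h2 := hgd z hz
    have : DifferentiableAt ℝ (fun z => (g z).2) z := h2.snd
    fun_prop
  have hdiv0 : ∀ z ∈ Ioo 0 L ×ˢ Ioo 0 R, fderiv ℝ F₁ z (1, 0) + fderiv ℝ F₂ z (0, 1) = 0 := by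
    intro z hz
    have hq' := (hqd z hz).hasFDerivAt
    have hg' := (hgd z hz).hasFDerivAt
    have hx : HasFDerivAt (fun z : ℝ × ℝ => k * z.1) (k • ContinuousLinearMap.fst ℝ ℝ ℝ) z :=
      (hasFDerivAt_fst).const_mul k
    have hy : HasFDerivAt (fun z : ℝ × ℝ => k * z.2) (k • ContinuousLinearMap.snd ℝ ℝ ℝ) z :=
      (hasFDerivAt_snd).const_mul k
    have e1 := ((hg'.fst).mul (hx.sin.mul hy.cosh)).sub (hq'.mul ((hx.cos.const_mul k).mul hy.cosh))
    have e2 := ((hg'.snd).mul (hx.sin.mul hy.cosh)).sub (hq'.mul ((hx.sin.const_mul k).mul hy.sinh))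
    have e1' : HasFDerivAt F₁ _ z := e1
    have e2' : HasFDerivAt F₂ _ z := e2
    rw [e1'.fderiv, e2'.fderiv]
    have hgr := hgrad z hz
    have hdv := hdiv z hz
    have g1 : fderiv ℝ q z (1, 0) = (g z).1 := congrArg Prod.fst hgr
    have g2 : fderiv ℝ q z (0, 1) = (g z).2 := congrArg Prod.snd hgr
    simp only [divergence] at hdv
    simp [g1, g2]
    linear_combination (Real.sin (k * z.1) * Real.cosh (k * z.2)) * hdv
  have hae : (fun z => fderiv ℝ F₁ z (1, 0) + fderiv ℝ F₂ z (0, 1))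
      =ᵐ[volume.restrict (Icc ((0 : ℝ), (0 : ℝ)) (L, R))] 0 := by
    have hres : volume.restrict (Icc ((0 : ℝ), (0 : ℝ)) (L, R))
        = volume.restrict (Ioo (0 : ℝ) L ×ˢ Ioo (0 : ℝ) R) := by
      rw [hIcc, Measure.volume_eq_prod, ← Measure.prod_restrict, ← Measure.prod_restrict,
        Measure.restrict_congr_set Ioo_ae_eq_Icc, Measure.restrict_congr_set Ioo_ae_eq_Icc]
    rw [hres]
    exact (ae_restrict_iff' (measurableSet_Ioo.prod measurableSet_Ioo)).2
      (Eventually.of_forall hdiv0)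
  have hfst : ContinuousOn (fun z => (g z).1) (Icc 0 L ×ˢ Icc 0 R) := hgc.fst
  have hsnd : ContinuousOn (fun z => (g z).2) (Icc 0 L ×ˢ Icc 0 R) := hgc.snd
  have key := integral_divergence_prod_Icc_of_hasFDerivAt_of_le F₁ F₂
    (fun z => fderiv ℝ F₁ z) (fun z => fderiv ℝ F₂ z) (0, 0) (L, R) ⟨hL.le, hR.le⟩
    (by rw [hIcc]; fun_prop) (by rw [hIcc]; fun_prop)
    (fun z hz => (hd₁ z hz).hasFDerivAt) (fun z hz => (hd₂ z hz).hasFDerivAt)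
    ((integrable_zero _ _ _).congr hae.symm)
  rw [integral_congr_ae hae] at key
  have congr0 : ∀ {a : ℝ} {f f' : ℝ → ℝ}, 0 < a → (∀ x ∈ Ioo 0 a, f x = f' x) →
      ∫ x in (0 : ℝ)..a, f x = ∫ x in (0 : ℝ)..a, f' x := fun ha h =>
    intervalIntegral.integral_congr_Ioo_of_le ha.le h
  have hbot : ∫ x in (0 : ℝ)..L, F₂ (x, 0) = 0 := by
    rw [congr0 hL (f' := fun _ => 0) fun x hx => by simp [hF₂, hg0 x hx]]; simp
  have hleft : ∫ y in (0 : ℝ)..R, F₁ (0, y) = 0 := by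
    rw [congr0 hR (f' := fun _ => 0) fun x hx => by simp [hF₁, hq0 x hx]]; simp
  have hright : ∫ y in (0 : ℝ)..R, F₁ (L, y) = 0 := by
    rw [congr0 hR (f' := fun _ => 0) fun x hx => by simp [hF₁, hqL x hx, hk]]; simp
  simp only [hbot, hleft, hright, Pi.zero_apply, integral_zero, sub_zero, add_zero] at key
  have hmap : ContinuousOn (fun x : ℝ => (x, R)) (Icc 0 L) := by fun_prop
  have hmaps : MapsTo (fun x : ℝ => (x, R)) (Icc 0 L) (Icc 0 L ×ˢ Icc 0 R) :=
    fun x hx => ⟨hx, hR.le, le_rfl⟩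
  have i1 : IntervalIntegrable (fun x => (g (x, R)).2 * Real.sin (k * x)) volume 0 L := by
    apply ContinuousOn.intervalIntegrable
    rw [uIcc_of_le hL.le]
    exact (hsnd.comp hmap hmaps).mul (by fun_prop)
  have i2 : IntervalIntegrable (fun x => q (x, R) * Real.sin (k * x)) volume 0 L := by
    apply ContinuousOn.intervalIntegrable
    rw [uIcc_of_le hL.le]
    exact (hqc.comp hmap hmaps).mul (by fun_prop)
  have : ∫ x in (0 : ℝ)..L, F₂ (x, R)
      = Real.cosh (k * R) * (∫ x in (0 : ℝ)..L, (g (x, R)).2 * Real.sin (k * x))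
      - k * Real.sinh (k * R) * ∫ x in (0 : ℝ)..L, q (x, R) * Real.sin (k * x) := by
    rw [← intervalIntegral.integral_const_mul, ← intervalIntegral.integral_const_mul,
      ← intervalIntegral.integral_sub (i1.const_mul _) (i2.const_mul _)]
    refine intervalIntegral.integral_congr fun x _ => ?_
    simp only [hF₂]
    ring
  linarith

/-! ### Parseval's identity for sine series -/

/-- The sine coefficient `∫₀ᴸ f(x) sin(kπx/L) dx`, without normalization. -/
def sineCoeff (L : ℝ) (f : ℝ → ℝ) (k : ℤ) : ℝ :=
  ∫ x in (0 : ℝ)..L, f x * Real.sin (k * Real.pi / L * x)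

theorem abs_sineCoeff_natAbs (L : ℝ) (f : ℝ → ℝ) (k : ℤ) :
    |sineCoeff L f k.natAbs| = |sineCoeff L f k| := by
  rcases Int.natAbs_eq k with h | h
  · rw [← h]
  · have : sineCoeff L f k = -sineCoeff L f k.natAbs := by
      rw [h, sineCoeff, sineCoeff, ← intervalIntegral.integral_neg]
      refine intervalIntegral.integral_congr fun x _ => ?_
      simp [neg_mul, neg_div]
    rw [this, abs_neg]

theorem sineCoeff_zero_right (L : ℝ) (f : ℝ → ℝ) : sineCoeff L f 0 = 0 := by
  simp [sineCoeff]

theorem memLp_Ioo_of_continuousOn {L : ℝ} {f : ℝ → ℝ} (hf : ContinuousOn f (Icc 0 L)) :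
    MemLp f 2 (volume.restrict (Ioo 0 L)) := by
  obtain ⟨C, hC⟩ := isCompact_Icc.exists_bound_of_continuousOn hf
  refine MemLp.of_bound ((hf.mono Ioo_subset_Icc_self).aestronglyMeasurable measurableSet_Ioo) C ?_
  exact (ae_restrict_iff' measurableSet_Ioo).2
    (Eventually.of_forall fun x hx => hC x (Ioo_subset_Icc_self hx))

theorem integral_eq_integral_add_comp_neg {E : Type*} [NormedAddCommGroup E] [NormedSpace ℝ E]
    {L : ℝ} (hL : 0 ≤ L) {h : ℝ → E} (hh : IntervalIntegrable h volume (-L) L) :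
    ∫ x in (-L)..L, h x = ∫ x in (0 : ℝ)..L, (h x + h (-x)) := by
  have h1 : IntervalIntegrable h volume (-L) 0 := hh.mono_set (by
    rw [uIcc_of_le (by linarith), uIcc_of_le (by linarith)]
    exact Icc_subset_Icc le_rfl hL)
  have h2 : IntervalIntegrable h volume 0 L := hh.mono_set (by
    rw [uIcc_of_le (by linarith), uIcc_of_le (by linarith)]
    exact Icc_subset_Icc (by linarith) le_rfl)
  have h3 : IntervalIntegrable (fun x => h (-x)) volume 0 L := by
    simpa using ((IntervalIntegrable.iff_comp_neg).1 h1).symm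
  rw [← intervalIntegral.integral_add_adjacent_intervals h1 h2,
    intervalIntegral.integral_add h2 h3]
  simp [add_comm]

/-- Parseval's identity for the odd extension of `f`. The sum over `ℤ` counts each frequency
twice. -/
theorem hasSum_sq_sineCoeff {L : ℝ} (hL : 0 < L) {f : ℝ → ℝ} (hf : ContinuousOn f (Icc 0 L)) :
    HasSum (fun k : ℤ => sineCoeff L f k ^ 2) (L * ∫ x in (0 : ℝ)..L, f x ^ 2) := by
  set g : ℝ → ℂ := (Ioo 0 L).indicator fun x => (f x : ℂ) with hg
  have hgL : MemLp g 2 volume := by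
    rw [hg, memLp_indicator_iff_restrict measurableSet_Ioo]
    exact (memLp_Ioo_of_continuousOn hf).ofReal
  have hgneg : MemLp (fun x => g (-x)) 2 volume :=
    hgL.comp_measurePreserving (Measure.measurePreserving_neg volume)
  set F : ℝ → ℂ := fun x => g x - g (-x) with hF
  have hFL : MemLp F 2 volume := hgL.sub hgneg
  have hpos : ∀ x ∈ Ioo 0 L, F x = f x := fun x hx => by
    simp [hF, hg, indicator, hx.1, hx.2, hx.1.le.not_gt]
  have hodd : ∀ x, F (-x) = - F x := fun x => by simp [hF]
  have hLL : -L < L := by linarith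
  have hmem2 : MemLp F 2 (volume.restrict (Ioc (-L) L)) := hFL.restrict _
  have hpars := hasSum_sq_fourierCoeffOn hLL hmem2
  have hFint : IntervalIntegrable F volume (-L) L :=
    (intervalIntegrable_iff_integrableOn_Ioc_of_le hLL.le).2 (hmem2.integrable (by norm_num))
  have hF2 : IntervalIntegrable (fun x => ‖F x‖ ^ 2) volume (-L) L :=
    (intervalIntegrable_iff_integrableOn_Ioc_of_le hLL.le).2
      (hmem2.integrable_norm_pow (by norm_num))
  have hcoeff : ∀ k : ℤ, ‖fourierCoeffOn hLL F k‖ ^ 2 = (L ^ 2)⁻¹ * sineCoeff L f k ^ 2 := by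
    intro k
    set h : ℝ → ℂ := fun x => fourier (-k) (x : AddCircle (L - -L)) • F x with hh
    have hint : IntervalIntegrable h volume (-L) L := by
      refine hFint.continuousOn_smul (Continuous.continuousOn ?_)
      exact (fourier (-k)).continuous.comp (AddCircle.continuous_mk' _)
    have hval : ∫ x in (-L)..L, h x = (-2 * Complex.I) * (sineCoeff L f k : ℂ) := by
      rw [integral_eq_integral_add_comp_neg hL.le hint, sineCoeff,
        ← intervalIntegral.integral_ofReal, ← intervalIntegral.integral_const_mul]
      refine intervalIntegral.integral_congr_Ioo_of_le hL.le fun x hx => ?_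
      simp only [hh, hodd, hpos x hx, fourier_coe_apply, smul_eq_mul]
      have hLc : (L : ℂ) ≠ 0 := by exact_mod_cast hL.ne'
      have e1 : 2 * (Real.pi : ℂ) * Complex.I * ((-k : ℤ) : ℂ) * (x : ℂ) / ((L - -L : ℝ) : ℂ)
          = -(k * Real.pi / L * x : ℂ) * Complex.I := by
        push_cast; field_simp; ring
      have e2 : 2 * (Real.pi : ℂ) * Complex.I * ((-k : ℤ) : ℂ) * ((-x : ℝ) : ℂ) / ((L - -L : ℝ) : ℂ)
          = (k * Real.pi / L * x : ℂ) * Complex.I := by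
        push_cast; field_simp; ring
      rw [e1, e2]
      push_cast
      rw [Complex.sin]
      linear_combination ((Complex.exp (-(k * Real.pi / L * x : ℂ) * Complex.I)
        - Complex.exp ((k * Real.pi / L * x : ℂ) * Complex.I)) * (f x : ℂ)) * Complex.I_sq
    rw [fourierCoeffOn_eq_integral, hval, norm_smul, norm_mul]
    simp only [norm_mul, norm_neg, Complex.norm_I, Complex.norm_real, Complex.norm_ofNat,
      Real.norm_eq_abs, mul_pow, sq_abs]
    field_simp
    ring
  have hnorm : ∫ x in (-L)..L, ‖F x‖ ^ 2 = 2 * ∫ x in (0 : ℝ)..L, f x ^ 2 := by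
    rw [integral_eq_integral_add_comp_neg hL.le hF2, ← intervalIntegral.integral_const_mul]
    refine intervalIntegral.integral_congr_Ioo_of_le hL.le fun x hx => ?_
    simp only [hodd, norm_neg, hpos x hx, Complex.norm_real, Real.norm_eq_abs, sq_abs]
    ring
  rw [hnorm] at hpars
  simp only [hcoeff] at hpars
  have hmul := hpars.mul_left (L ^ 2)
  simp only [mul_inv_cancel_left₀ (pow_ne_zero 2 hL.ne'), smul_eq_mul] at hmul
  have e : ∀ I : ℝ, L ^ 2 * ((L - -L)⁻¹ * (2 * I)) = L * I := fun I => by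
    field_simp
    ring
  rwa [e] at hmul

namespace Benchmark
variable (B : Benchmark)

/-! ### The recurrence of one mode -/

theorem μ_pos {i : ℕ} (hi : 1 ≤ i) : 0 < B.μ i := by
  have hL := B.L_pos
  have hR := B.R_pos
  have hi' : (0 : ℝ) < i := by exact_mod_cast hi
  have hx : 0 < i * Real.pi * B.R / B.L := by positivity
  have : 0 < Real.tanh (i * Real.pi * B.R / B.L) := by
    rw [Real.tanh_eq_sinh_div_cosh]
    exact div_pos (Real.sinh_pos_iff.2 hx) (Real.cosh_pos _)
  unfold μ
  positivity

theorem aeval_χ (α dt : ℝ) (i : ℕ) (y : ℂ) : Polynomial.aeval y (B.χ α dt i)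
    = modalPoly (B.ρs * B.hs / dt ^ 2) B.β α (B.ρf * B.μ i / dt ^ 2) y := by
  simp [χ, modalPoly]

/-- The condition `α ≤ αbar i`, cleared of denominators. It is automatic for the modes with
mass ratio at least one, where `αbar i ≥ 1`. -/
theorem mul_add_le_of_lt_αbar {α dt : ℝ} (hα1 : α ≤ 1) (hdt : 0 < dt) {i : ℕ}
    (hi : 1 ≤ i) (h : B.massRatio i < 1 → α < B.αbar i) :
    α * (B.ρs * B.hs / dt ^ 2 + B.ρf * B.μ i / dt ^ 2) ≤ 2 * (B.ρs * B.hs / dt ^ 2) := by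
  have hs : 0 < B.ρs * B.hs := mul_pos B.ρs_pos B.hs_pos
  have hf : 0 < B.ρf * B.μ i := mul_pos B.ρf_pos (B.μ_pos hi)
  suffices hk : α * (B.ρs * B.hs + B.ρf * B.μ i) ≤ 2 * (B.ρs * B.hs) by
    rw [← add_div, mul_div_assoc', mul_div_assoc']
    gcongr
  by_cases hr : B.massRatio i < 1
  · have h1 := h hr
    have hr0 : 0 < B.massRatio i := div_pos hs hf
    have hrf : B.massRatio i * (B.ρf * B.μ i) = B.ρs * B.hs := div_mul_cancel₀ _ hf.ne'
    rw [αbar, lt_div_iff₀ (by positivity)] at h1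
    rw [← hrf]
    nlinarith
  · rw [massRatio, not_lt, le_div_iff₀ hf] at hr
    nlinarith

theorem αbar_lt_one {i : ℕ} (hi : 1 ≤ i) (h : B.massRatio i < 1) : B.αbar i < 1 := by
  have hs : 0 < B.ρs * B.hs := mul_pos B.ρs_pos B.hs_pos
  have hf : 0 < B.ρf * B.μ i := mul_pos B.ρf_pos (B.μ_pos hi)
  have hr : 0 < B.massRatio i := div_pos hs hf
  rw [αbar, div_lt_one (by linarith)]
  linarith

variable {B}

/-- The trace of the fluid on the interface acts on the mode `i` as an added mass `ρf μ i`: the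
sine coefficients of the displacement satisfy the recurrence with characteristic polynomial `χ`.
The combinations `p (m + 1) - (1 - α) p m` are harmonic only after the initial levels have been
left behind, so the recurrence starts from level `2`. -/
theorem IsLCDNSolution.sineCoeff_recurrence {α dt : ℝ} (hdt : 0 < dt)
    {u : ℕ → ℝ × ℝ → ℝ × ℝ} {p : ℕ → ℝ × ℝ → ℝ} {η w : ℕ → ℝ → ℝ}
    (h : B.IsLCDNSolution α dt u p η w) {i : ℕ} (hi : 1 ≤ i) (n : ℕ) :
    (B.ρs * B.hs / dt ^ 2 + B.β) * sineCoeff B.L (η (n + 5)) i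
      + (α * (B.ρf * B.μ i / dt ^ 2) - B.β * (1 - α) - 3 * (B.ρs * B.hs / dt ^ 2)
        + α * (B.ρs * B.hs / dt ^ 2)) * sineCoeff B.L (η (n + 4)) i
      + (3 * (B.ρs * B.hs / dt ^ 2) - 2 * α * (B.ρf * B.μ i / dt ^ 2)
        - 2 * α * (B.ρs * B.hs / dt ^ 2)) * sineCoeff B.L (η (n + 3)) i
      + (-(1 - α) * (B.ρs * B.hs / dt ^ 2) + α * (B.ρf * B.μ i / dt ^ 2))
        * sineCoeff B.L (η (n + 2)) i = 0 := by
  have hL := B.L_pos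
  have hR := B.R_pos
  have hi' : (0 : ℝ) < i := by exact_mod_cast hi
  set k : ℝ := i * Real.pi / B.L with hk
  have hk0 : 0 < k := by positivity
  set M := B.ρs * B.hs / dt ^ 2 with hM
  set q : ℝ × ℝ → ℝ := fun z => p (n + 5) z - (1 - α) * p (n + 4) z with hq
  set g : ℝ × ℝ → ℝ × ℝ := fun z => -(B.ρf / dt) •
    ((u (n + 5) z - (1 - α) • u (n + 4) z) - (u (n + 4) z - (1 - α) • u (n + 3) z)) with hg
  have huc := h.u_cont
  have hpc := h.p_cont
  unfold closedFluidDomain at huc hpc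
  have hdivg : ∀ z ∈ B.fluidDomain, divergence g z = 0 := fun z hz => by
    have d5 := (h.u_diff (n + 5) z hz).hasFDerivAt
    have d4 := (h.u_diff (n + 4) z hz).hasFDerivAt
    have d3 := (h.u_diff (n + 3) z hz).hasFDerivAt
    have hd : HasFDerivAt g _ z :=
      ((d5.sub (d4.const_smul (1 - α))).sub (d4.sub (d3.const_smul (1 - α)))).const_smul
        (-(B.ρf / dt))
    have c5 := h.continuity (n + 2) z hz
    have c4 := h.continuity (n + 1) z hz
    simp only [divergence, hd.fderiv] at c5 c4 ⊢
    simp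
    linear_combination (-(B.ρf / dt)) * (c5 - c4)
  have hgradq : ∀ z ∈ B.fluidDomain, grad q z = g z := fun z hz => by
    have d5 := (h.p_diff (n + 5) z hz).hasFDerivAt
    have d4 := (h.p_diff (n + 4) z hz).hasFDerivAt
    have hd : HasFDerivAt q _ z := d5.sub (d4.const_mul (1 - α))
    have m5 := h.momentum (n + 2) z hz
    have m51 := congrArg Prod.fst m5
    have m52 := congrArg Prod.snd m5
    simp only [grad, hd.fderiv] at m51 m52 ⊢
    simp at m51 m52
    ext
    · simp [hg]; linear_combination m51
    · simp [hg]; linear_combination m52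
  have hsin : Real.sin (k * B.L) = 0 := by
    rw [hk, div_mul_cancel₀ _ hL.ne']; exact Real.sin_nat_mul_pi i
  have green := integral_normal_deriv_mul_sin hL hR hsin (q := q) (g := g)
    ((hpc _).sub ((hpc _).const_smul (1 - α)))
    ((((huc (n + 5)).sub ((huc (n + 4)).const_smul (1 - α))).sub
      ((huc (n + 4)).sub ((huc (n + 3)).const_smul (1 - α)))).const_smul (-(B.ρf / dt)))
    (fun z hz => (h.p_diff _ z hz).sub ((h.p_diff _ z hz).const_mul _))
    (fun z hz => (((h.u_diff (n + 5) z hz).sub ((h.u_diff (n + 4) z hz).const_smul (1 - α))).sub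
      ((h.u_diff (n + 4) z hz).sub ((h.u_diff (n + 3) z hz).const_smul (1 - α)))).const_smul
        (-(B.ρf / dt)))
    hgradq hdivg
    (fun y hy => by simp [hq, h.p_inlet _ y hy]) (fun y hy => by simp [hq, h.p_outlet _ y hy])
    (fun x hx => by simp [hg, h.u_symm _ x hx])
  have hint : ∀ m, IntervalIntegrable (fun x => η m x * Real.sin (k * x)) volume 0 B.L :=
    fun m => by
      apply ContinuousOn.intervalIntegrable
      rw [uIcc_of_le hL.le]
      exact (h.η_cont m).mul (by fun_prop)
  have hlin : ∀ (f : ℝ → ℝ) (a b c d : ℝ), (∀ x ∈ Ioo 0 B.L, f x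
      = a * η (n + 5) x + b * η (n + 4) x + c * η (n + 3) x + d * η (n + 2) x) →
      ∫ x in (0 : ℝ)..B.L, f x * Real.sin (k * x) = a * sineCoeff B.L (η (n + 5)) i
        + b * sineCoeff B.L (η (n + 4)) i + c * sineCoeff B.L (η (n + 3)) i
        + d * sineCoeff B.L (η (n + 2)) i := fun f a b c d hf => by
    have hS : ∀ m, sineCoeff B.L (η m) i = ∫ x in (0 : ℝ)..B.L, η m x * Real.sin (k * x) :=
      fun m => by simp [sineCoeff, hk]
    simp only [hS, ← intervalIntegral.integral_const_mul]
    rw [← intervalIntegral.integral_add ((hint _).const_mul _) ((hint _).const_mul _),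
      ← intervalIntegral.integral_add (((hint _).const_mul _).add ((hint _).const_mul _))
        ((hint _).const_mul _),
      ← intervalIntegral.integral_add ((((hint _).const_mul _).add ((hint _).const_mul _)).add
        ((hint _).const_mul _)) ((hint _).const_mul _)]
    refine intervalIntegral.integral_congr_Ioo_of_le hL.le fun x hx => ?_
    simp only [hf x hx]
    ring
  rw [hlin (fun x => (g (x, B.R)).2) 0 (-(B.ρf * α / dt ^ 2)) (2 * (B.ρf * α / dt ^ 2))
      (-(B.ρf * α / dt ^ 2)) fun x hx => ?_,
    hlin (fun x => q (x, B.R)) (M + B.β) (-2 * M - (1 - α) * (M + B.β)) (M + (1 - α) * (2 * M))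
      (-(1 - α) * M) fun x hx => ?_] at green
  · have hμ : B.μ i = Real.cosh (k * B.R) / (k * Real.sinh (k * B.R)) := by
      rw [μ, Real.tanh_eq_sinh_div_cosh,
        show i * Real.pi * B.R / B.L = k * B.R by rw [hk]; ring, hk]
      have := Real.cosh_pos (i * Real.pi / B.L * B.R)
      field_simp
    have hsinh : 0 < Real.sinh (k * B.R) := Real.sinh_pos_iff.2 (by positivity)
    have hden : k * Real.sinh (k * B.R) ≠ 0 := by positivity
    have trace := (eq_div_iff hden).2 ((mul_comm _ _).trans green.symm)
    rw [hμ, mul_div_assoc'] at *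
    linear_combination trace
  · have e := h.membrane (n + 2) x hx
    simp only [hq, hM]
    linear_combination -e
  · have e5 := h.interface (n + 2) x hx
    have e4 := h.interface (n + 1) x hx
    have v5 := h.velocity (n + 1) x hx
    have v4 := h.velocity n x hx
    simp [hg]
    rw [e5, e4, v5, v4]
    field_simp
    ring

end Benchmark

/-! ### Convergence in `L²(Σ)` -/

theorem eLpNorm_two_Ioo {L : ℝ} (hL : 0 < L) {f : ℝ → ℝ} (hf : ContinuousOn f (Icc 0 L)) :
    eLpNorm f 2 (volume.restrict (Ioo 0 L)) = ENNReal.ofReal (√(∫ x in (0 : ℝ)..L, f x ^ 2)) := by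
  rw [(memLp_Ioo_of_continuousOn hf).eLpNorm_eq_integral_rpow_norm (by norm_num) (by norm_num),
    Real.sqrt_eq_rpow, intervalIntegral.integral_of_le hL.le, integral_Ioc_eq_integral_Ioo]
  simp

/-- A bound on all sine coefficients with a common factor gives a bound in `L²`. -/
theorem integral_sq_le_of_sineCoeff_le {L : ℝ} (hL : 0 < L) {f g₀ g₁ g₂ : ℝ → ℝ} {κ : ℝ}
    (hf : ContinuousOn f (Icc 0 L)) (h₀ : ContinuousOn g₀ (Icc 0 L))
    (h₁ : ContinuousOn g₁ (Icc 0 L)) (h₂ : ContinuousOn g₂ (Icc 0 L))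
    (h : ∀ k : ℤ, |sineCoeff L f k|
      ≤ κ * (|sineCoeff L g₀ k| + |sineCoeff L g₁ k| + |sineCoeff L g₂ k|)) :
    ∫ x in (0 : ℝ)..L, f x ^ 2 ≤ κ ^ 2 * (3 * ((∫ x in (0 : ℝ)..L, g₀ x ^ 2)
      + (∫ x in (0 : ℝ)..L, g₁ x ^ 2) + ∫ x in (0 : ℝ)..L, g₂ x ^ 2)) := by
  have hs := (((hasSum_sq_sineCoeff hL h₀).add (hasSum_sq_sineCoeff hL h₁)).add
    (hasSum_sq_sineCoeff hL h₂)).mul_left (κ ^ 2 * 3)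
  have := hasSum_le (fun k => ?_) (hasSum_sq_sineCoeff hL hf) hs
  · refine le_of_mul_le_mul_left (this.trans_eq ?_) hL
    ring
  · set a := |sineCoeff L g₀ k|
    set b := |sineCoeff L g₁ k|
    set c := |sineCoeff L g₂ k|
    calc sineCoeff L f k ^ 2 = |sineCoeff L f k| ^ 2 := (sq_abs _).symm
      _ ≤ (κ * (a + b + c)) ^ 2 := by gcongr; exact h k
      _ = κ ^ 2 * (a + b + c) ^ 2 := by ring
      _ ≤ κ ^ 2 * (3 * (a ^ 2 + b ^ 2 + c ^ 2)) := by
        gcongr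
        nlinarith [sq_nonneg (a - b), sq_nonneg (b - c), sq_nonneg (a - c)]
      _ = _ := by simp only [a, b, c, sq_abs]; ring

theorem tendsto_zero_of_le_mul_add {a b : ℕ → ℝ} {r : ℝ} (hr : 0 ≤ r) (hr1 : r < 1)
    (ha : ∀ n, 0 ≤ a n) (hb : Tendsto b atTop (𝓝 0)) (h : ∀ n, a (n + 1) ≤ r * a n + b n) :
    Tendsto a atTop (𝓝 0) := by
  rw [Metric.tendsto_atTop]
  intro ε hε
  obtain ⟨N, hN⟩ := eventually_atTop.1 (hb.eventually_le_const
    (show (0 : ℝ) < (1 - r) * (ε / 2) by have := sub_pos.2 hr1; positivity))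
  -- the excess of `a` over `ε / 2` is contracted by the factor `r`
  have hex : ∀ m, a (N + m) - ε / 2 ≤ r ^ m * a N := fun m => by
    induction m with
    | zero => simp; linarith
    | succ m ih =>
      have h1 := h (N + m)
      have h2 := hN (N + m) (by omega)
      have h3 := mul_le_mul_of_nonneg_left ih hr
      rw [← add_assoc, pow_succ]
      linarith
  have hpow : Tendsto (fun m => r ^ m * a N) atTop (𝓝 0) := by
    simpa using (tendsto_pow_atTop_nhds_zero_of_lt_one hr hr1).mul_const (a N)
  obtain ⟨K, hK⟩ := eventually_atTop.1 (hpow.eventually_lt_const (half_pos hε))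
  refine ⟨N + K, fun n hn => ?_⟩
  obtain ⟨m, rfl⟩ := Nat.exists_eq_add_of_le (show N ≤ n by omega)
  rw [Real.dist_0_eq_abs, abs_of_nonneg (ha _)]
  linarith [hex m, hK m (by omega)]

namespace Benchmark
variable {B : Benchmark}

theorem TendstoZeroL2.of_shift {f g : ℕ → ℝ → ℝ} (m : ℕ) (hg : B.TendstoZeroL2 g)
    (h : ∀ n, ∀ x ∈ Ioo 0 B.L, f (n + m) x = g n x) : B.TendstoZeroL2 f := by
  unfold TendstoZeroL2 at *
  rw [← tendsto_add_atTop_iff_nat m]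
  refine hg.congr fun n => eLpNorm_congr_ae ?_
  exact (ae_restrict_iff' measurableSet_Ioo).2 (Eventually.of_forall fun x hx => (h n x hx).symm)

theorem TendstoZeroL2.shift {f : ℕ → ℝ → ℝ} (m : ℕ) (hf : B.TendstoZeroL2 f) :
    B.TendstoZeroL2 fun n => f (n + m) :=
  (tendsto_add_atTop_iff_nat m).2 hf

theorem TendstoZeroL2.const_mul {f : ℕ → ℝ → ℝ} (c : ℝ) (hf : B.TendstoZeroL2 f) :
    B.TendstoZeroL2 fun n x => c * f n x := by
  have := ENNReal.Tendsto.const_mul hf (a := ‖c‖ₑ) (Or.inr enorm_ne_top)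
  rw [mul_zero] at this
  exact this.congr fun n => (eLpNorm_const_smul c (f n) 2 _).symm

theorem TendstoZeroL2.add {f g : ℕ → ℝ → ℝ} (hf : B.TendstoZeroL2 f) (hg : B.TendstoZeroL2 g)
    (hfm : ∀ n, ContinuousOn (f n) (Icc 0 B.L)) (hgm : ∀ n, ContinuousOn (g n) (Icc 0 B.L)) :
    B.TendstoZeroL2 fun n x => f n x + g n x := by
  have := Tendsto.add hf hg
  rw [add_zero] at this
  exact tendsto_of_tendsto_of_tendsto_of_le_of_le tendsto_const_nhds this (fun _ => zero_le)
    fun n => eLpNorm_add_le (memLp_Ioo_of_continuousOn (hfm n)).1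
      (memLp_Ioo_of_continuousOn (hgm n)).1 (by norm_num)

/-- Sequences in `L²(Σ)` driven by a contraction and a forcing term that tends to zero. -/
theorem TendstoZeroL2.of_contraction {f g : ℕ → ℝ → ℝ} {r : ℝ} (hr : 0 ≤ r) (hr1 : r < 1)
    (hg : B.TendstoZeroL2 g)
    (hfm : ∀ n, ContinuousOn (f n) (Icc 0 B.L)) (hgm : ∀ n, ContinuousOn (g n) (Icc 0 B.L))
    (h : ∀ n, ∀ x ∈ Ioo 0 B.L, f (n + 1) x = r * f n x + g n x) : B.TendstoZeroL2 f := by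
  have hfL := fun n => memLp_Ioo_of_continuousOn (hfm n)
  have hgL := fun n => memLp_Ioo_of_continuousOn (hgm n)
  have hg' := (ENNReal.tendsto_toReal ENNReal.zero_ne_top).comp hg
  have key : Tendsto (fun n => (eLpNorm (f n) 2 (volume.restrict (Ioo 0 B.L))).toReal)
      atTop (𝓝 0) := by
    refine tendsto_zero_of_le_mul_add hr hr1 (fun _ => ENNReal.toReal_nonneg) hg' fun n => ?_
    have hle : eLpNorm (f (n + 1)) 2 (volume.restrict (Ioo 0 B.L))
        ≤ ‖r‖ₑ * eLpNorm (f n) 2 (volume.restrict (Ioo 0 B.L))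
          + eLpNorm (g n) 2 (volume.restrict (Ioo 0 B.L)) := by
      rw [eLpNorm_congr_ae (g := r • f n + g n) ((ae_restrict_iff' measurableSet_Ioo).2
        (Eventually.of_forall fun x hx => h n x hx)), ← eLpNorm_const_smul]
      exact eLpNorm_add_le ((hfL n).1.const_smul r) (hgL n).1 (by norm_num)
    have hfin : ‖r‖ₑ * eLpNorm (f n) 2 (volume.restrict (Ioo 0 B.L)) ≠ ⊤ :=
      ENNReal.mul_ne_top enorm_ne_top (hfL n).2.ne
    have := ENNReal.toReal_mono (ENNReal.add_ne_top.2 ⟨hfin, (hgL n).2.ne⟩) hle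
    rwa [ENNReal.toReal_add hfin (hgL n).2.ne, ENNReal.toReal_mul, toReal_enorm,
      Real.norm_of_nonneg hr] at this
  have := ENNReal.tendsto_ofReal key
  rw [ENNReal.ofReal_zero] at this
  exact this.congr fun n => ENNReal.ofReal_toReal (hfL n).2.ne

/-! ### Stability of the scheme -/

/-- The displacement tends to zero: Parseval's identity together with the common decay rate of all
modes. -/
theorem IsLCDNSolution.tendstoZeroL2_displacement {α dt : ℝ} (hα0 : 0 < α) (hα1 : α ≤ 1)
    (hdt : 0 < dt) (hα : ∀ i : ℕ, 1 ≤ i → B.massRatio i < 1 → α < B.αbar i)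
    {u : ℕ → ℝ × ℝ → ℝ × ℝ} {p : ℕ → ℝ × ℝ → ℝ} {η w : ℕ → ℝ → ℝ}
    (h : B.IsLCDNSolution α dt u p η w) : B.TendstoZeroL2 η := by
  have hL := B.L_pos
  have hM : 0 < B.ρs * B.hs / dt ^ 2 :=
    div_pos (mul_pos B.ρs_pos B.hs_pos) (by positivity)
  obtain ⟨κ, hκ, hdecay⟩ := exists_uniform_decay hM B.β_pos hα0 hα1
  have hmode : ∀ n, ∀ k : ℤ, |sineCoeff B.L (η (n + 2)) k| ≤ κ n * (|sineCoeff B.L (η 2) k|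
      + |sineCoeff B.L (η 3) k| + |sineCoeff B.L (η 4) k|) := fun n k => by
    simp only [← abs_sineCoeff_natAbs B.L _ k]
    rcases Nat.eq_zero_or_pos k.natAbs with h0 | h0
    · simp [h0, sineCoeff_zero_right]
    · exact hdecay (B.ρf * B.μ k.natAbs / dt ^ 2)
        (div_pos (mul_pos B.ρf_pos (B.μ_pos h0)) (by positivity)).le
        (B.mul_add_le_of_lt_αbar hα1 hdt h0 (hα _ h0))
        (fun n => sineCoeff B.L (η (n + 2)) k.natAbs)
        (fun n => h.sineCoeff_recurrence hdt h0 n) n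
  refine TendstoZeroL2.of_shift 2 (g := fun n => η (n + 2)) ?_ fun _ _ _ => rfl
  set E := 3 * ((∫ x in (0 : ℝ)..B.L, η 2 x ^ 2)
      + (∫ x in (0 : ℝ)..B.L, η 3 x ^ 2) + ∫ x in (0 : ℝ)..B.L, η 4 x ^ 2)
  have hbound : Tendsto (fun n => ENNReal.ofReal √(κ n ^ 2 * E)) atTop (𝓝 0) := by
    have : Tendsto (fun n => √(κ n ^ 2 * E)) atTop (𝓝 √(0 ^ 2 * E)) :=
      ((hκ.pow 2).mul_const E).sqrt
    simpa using ENNReal.tendsto_ofReal this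
  refine tendsto_of_tendsto_of_tendsto_of_le_of_le tendsto_const_nhds hbound (fun _ => zero_le)
    fun n => ?_
  simp only [eLpNorm_two_Ioo hL (h.η_cont _)]
  gcongr
  exact integral_sq_le_of_sineCoeff_le hL (h.η_cont _) (h.η_cont _) (h.η_cont _)
    (h.η_cont _) (hmode n)

theorem absolutelyStable {α dt : ℝ} (hα0 : 0 < α) (hα1 : α ≤ 1)
    (hdt : 0 < dt) (hα : ∀ i : ℕ, 1 ≤ i → B.massRatio i < 1 → α < B.αbar i) :
    B.AbsolutelyStable α dt := by
  intro u p η w h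
  have hη := h.tendstoZeroL2_displacement hα0 hα1 hdt hα
  have hr : 0 ≤ 1 - α := by linarith
  have hr1 : 1 - α < 1 := by linarith
  have hc := h.η_cont
  have hcm : ∀ c n, ContinuousOn (fun x => c * η n x) (Icc 0 B.L) := fun c n =>
    continuousOn_const.mul (hc n)
  have hmaps : MapsTo (fun x : ℝ => (x, B.R)) (Icc 0 B.L) B.closedFluidDomain :=
    fun x hx => ⟨hx, B.R_pos.le, le_rfl⟩
  have hpc : ∀ n, ContinuousOn (fun x => p n (x, B.R)) (Icc 0 B.L) := fun n =>
    (h.p_cont n).comp (by fun_prop) hmaps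
  have hvc : ∀ n, ContinuousOn (fun x => (u n (x, B.R)).2) (Icc 0 B.L) := fun n =>
    ((h.u_cont n).comp (by fun_prop) hmaps).snd
  -- the velocity of the structure, with its values at the initial levels discarded
  have hw' : B.TendstoZeroL2 fun n x => (1 / dt) * η (n + 3) x + (-(1 / dt)) * η (n + 2) x :=
    ((hη.shift 3).const_mul _).add ((hη.shift 2).const_mul _)
      (fun _ => hcm _ _) (fun _ => hcm _ _)
  have hwc : ∀ n, ContinuousOn
      (fun x => (1 / dt) * η (n + 3) x + (-(1 / dt)) * η (n + 2) x) (Icc 0 B.L) :=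
    fun _ => (hcm _ _).add (hcm _ _)
  have hwe : ∀ n, ∀ x ∈ Ioo 0 B.L,
      w (n + 3) x = (1 / dt) * η (n + 3) x + (-(1 / dt)) * η (n + 2) x := fun n x hx => by
    rw [h.velocity n x hx]; ring
  refine ⟨hη, hw'.of_shift 3 hwe, ?_, ?_⟩
  · -- the residual of the structure equation at level `n + 2`, contracted by `1 - α` at each step
    set s : ℕ → ℝ → ℝ := fun n x => B.ρs * B.hs / dt ^ 2 * (η (n + 2) x - 2 * η (n + 1) x + η n x)
      + B.β * η (n + 2) x - p (n + 2) (x, B.R) with hs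
    have hsc : ∀ n, ContinuousOn (s n) (Icc 0 B.L) := fun n => by
      exact ((continuousOn_const.mul (((hc (n + 2)).sub (hcm 2 (n + 1))).add (hc n))).add
        (hcm _ _)).sub (hpc _)
    have hzero : B.TendstoZeroL2 fun _ _ => 0 := by
      simp [TendstoZeroL2]
    have hs0 : B.TendstoZeroL2 s := by
      refine TendstoZeroL2.of_contraction hr hr1 hzero hsc (fun _ => continuousOn_const)
        fun n x hx => ?_
      have := h.membrane n x hx
      simp only [hs]
      linear_combination this
    set M := B.ρs * B.hs / dt ^ 2 with hM
    have h1 : B.TendstoZeroL2 fun n x => (M + B.β) * η (n + 2) x + (-2 * M) * η (n + 1) x :=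
      ((hη.shift 2).const_mul _).add ((hη.shift 1).const_mul _)
        (fun _ => hcm _ _) (fun _ => hcm _ _)
    have h2 : B.TendstoZeroL2 fun n x => M * η n x + (-1) * s n x :=
      (hη.const_mul _).add (hs0.const_mul _)
        (fun _ => hcm _ _) (fun _ => continuousOn_const.mul (hsc _))
    refine (h1.add h2 (fun n => ?_) (fun n => ?_)).of_shift 2 fun n x hx => ?_
    · exact (hcm _ _).add (hcm _ _)
    · exact (hcm _ _).add (continuousOn_const.mul (hsc _))
    · simp only [hs]; ring
  · refine TendstoZeroL2.of_shift 4 (g := fun n x => (u (n + 4) (x, B.R)).2) ?_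
      fun _ _ _ => rfl
    refine TendstoZeroL2.of_contraction hr hr1 ((hw'.shift 1).const_mul α) (fun n => hvc _)
      (fun _ => continuousOn_const.mul (hwc _)) fun n x hx => ?_
    rw [← hwe (n + 1) x hx]
    exact h.interface (n + 2) x hx

/-- A single stable mode decays whatever the other modes do. -/
theorem modeAbsolutelyStable {α dt : ℝ} (hα0 : 0 < α) (hα1 : α ≤ 1) (hdt : 0 < dt) {i : ℕ}
    (hi : 1 ≤ i) (hα : B.massRatio i < 1 → α < B.αbar i) : B.ModeAbsolutelyStable α dt i := by
  have hM : 0 < B.ρs * B.hs / dt ^ 2 :=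
    div_pos (mul_pos B.ρs_pos B.hs_pos) (by positivity)
  have hA : 0 < B.ρf * B.μ i / dt ^ 2 := div_pos (mul_pos B.ρf_pos (B.μ_pos hi)) (by positivity)
  have hAM := B.mul_add_le_of_lt_αbar hα1 hdt hi hα
  refine ⟨fun y hy => ?_, fun u p η w h => ?_⟩
  · rw [aeval_χ] at hy
    exact norm_lt_one_of_modalPoly_eq_zero hM B.β_pos hα0 hα1 hA.le hAM hy
  · obtain ⟨κ, hκ, hdecay⟩ := exists_uniform_decay hM B.β_pos hα0 hα1
    have hle := hdecay _ hA.le hAM (fun n => sineCoeff B.L (η (n + 2)) i)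
      (fun n => h.sineCoeff_recurrence hdt hi n)
    have hlim : Tendsto (fun n => sineCoeff B.L (η n) i) atTop (𝓝 0) := by
      rw [← tendsto_add_atTop_iff_nat 2]
      refine squeeze_zero_norm hle ?_
      simpa using hκ.mul_const (|sineCoeff B.L (η 2) i| + |sineCoeff B.L (η 3) i|
        + |sineCoeff B.L (η 4) i|)
    have hmul := hlim.const_mul (√(2 / B.L))
    rw [mul_zero] at hmul
    refine hmul.congr fun n => ?_
    rw [sineCoeff, ← intervalIntegral.integral_const_mul]
    refine intervalIntegral.integral_congr fun x _ => ?_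
    simp only [z, Int.cast_natCast]
    rw [show i * Real.pi / B.L * x = i * Real.pi * x / B.L by ring]
    ring

end Benchmark
end FSI

end

theorem proposition3 (B : FSI.Benchmark) (α : ℝ) (hα0 : 0 < α) (hα1 : α ≤ 1) :
    (∀ i : ℕ, 1 ≤ i → B.massRatio i < 1 → B.αbar i < 1 ∧
      (α < B.αbar i → ∀ dt : ℝ, 0 < dt → B.ModeAbsolutelyStable α dt i)) ∧
    ((∀ i : ℕ, 1 ≤ i → B.massRatio i < 1 → α < B.αbar i) →
      B.UnconditionallyAbsolutelyStable α) :=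
  ⟨fun _ hi hr => ⟨B.αbar_lt_one hi hr, fun hα _ hdt =>
      FSI.Benchmark.modeAbsolutelyStable hα0 hα1 hdt hi fun _ => hα⟩,
    fun hα _ hdt => FSI.Benchmark.absolutelyStable hα0 hα1 hdt hα⟩
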